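/- Let $n\ge 2$ and $d,r\ge 0$ be integers with $0\le r\le (n-1)d$. Let $K_n^d$ be the Hamming graph, i.e. the Cartesian product of $d$ copies of the complete graph $K_n$: its vertices are the $d$-tuples over an $n$-element set, and two tuples are adjacent if and only if they differ in exactly one coordinate. Let $S_{r+1}$ denote the star with $r+1$ edges. The $r$-edge bootstrap percolation process on a finite graph $G$ starts from a set $E_0\subseteq E(G)$ of active edges, and for each $i\ge 1$ $$E_i=E_{i-1}\cup\{e\in E(G) : G \text{ has a subgraph } H_e\cong S_{r+1} \text{ with } e\in E(H_e) \text{ and } E(H_e)\setminus\{e\}\subseteq E_{i-1}\};$$ that is, an inactive edge becomes active as soon as one of its endpoints is incident to at least $r$ active edges. The set $E_0$ is percolating if $E_t=E(G)$ for some $t\ge 0$, and $m_e(G,r)$ denotes the minimum size of a percolating set. Then $$m_e(K_n^d,r)=\sum_{i_1=0}^{r-1}\ \sum_{i_2=0}^{r-i_1-1}\cdots\sum_{i_{n-1}=0}^{r-i_1-\cdots-i_{n-2}-1}(r-i_1-\cdots-i_{n-1})\binom{d}{i_1}\binom{i_1}{i_2}\cdots\binom{i_{n-2}}{i_{n-1}},$$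 where each $i_k$ ranges over the integers $0\le i_k\le r-i_1-\cdots-i_{k-1}-1$ (and a sum with upper limit $-1$ is empty). -/

import Mathlib

namespace HammingBootstrap

/-- The `d`-th Cartesian power `G^d`: two `d`-tuples are adjacent when they differ in exactly one
coordinate, and there their entries are adjacent in `G`. -/
def cartesianPower {α : Type*} (G : SimpleGraph α) (d : ℕ) : SimpleGraph (Fin d → α) where
  Adj u v := ∃ k : Fin d, G.Adj (u k) (v k) ∧ ∀ j : Fin d, j ≠ k → u j = v j
  symm := ⟨fun _ _ ⟨k, h, h'⟩ => ⟨k, h.symm, fun j hj => (h' j hj).symm⟩⟩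
  loopless := ⟨fun _ ⟨_, h, _⟩ => h.ne rfl⟩

/-- The Hamming graph `K_n^d`: the `d`-th Cartesian power of the complete graph on `n` vertices. -/
def hammingGraph (n d : ℕ) : SimpleGraph (Fin d → Fin n) :=
  cartesianPower (⊤ : SimpleGraph (Fin n)) d

/-- The star `S_m` with `m` edges (vertices `0, …, m`, centre `0`). -/
def starWithEdges (m : ℕ) : SimpleGraph (Fin (m + 1)) := SimpleGraph.starGraph 0

section Percolation

variable {V W : Type*}

/-- The edges `e` of `G` lying in a copy of `H` in `G` all of whose other edges belong to `E`. -/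
def newlyActive (G : SimpleGraph V) (H : SimpleGraph W) (E : Set (Sym2 V)) : Set (Sym2 V) :=
  {e | e ∈ G.edgeSet ∧ ∃ S : G.Subgraph,
    Nonempty (S.coe ≃g H) ∧ e ∈ S.edgeSet ∧ S.edgeSet \ {e} ⊆ E}

/-- The set of active edges after `t` steps of the `H`-bootstrap percolation process on `G` that
starts from `E₀`. -/
def activeEdges (G : SimpleGraph V) (H : SimpleGraph W) (E₀ : Set (Sym2 V)) : ℕ → Set (Sym2 V)
  | 0 => E₀
  | t + 1 => activeEdges G H E₀ t ∪ newlyActive G H (activeEdges G H E₀ t)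

/-- `E₀` is a percolating set of `G` in the `H`-bootstrap percolation process. -/
def IsPercolating (G : SimpleGraph V) (H : SimpleGraph W) (E₀ : Set (Sym2 V)) : Prop :=
  E₀ ⊆ G.edgeSet ∧ ∃ t : ℕ, activeEdges G H E₀ t = G.edgeSet

/-- The weak saturation number `wsat(G, H)` of a finite graph `G`: the minimum size of a percolating
set in the `H`-bootstrap percolation process on `G`. -/
noncomputable def weakSat [Finite V] (G : SimpleGraph V) (H : SimpleGraph W) : ℕ :=
  sInf {k | ∃ E₀ : Set (Sym2 V), IsPercolating G H E₀ ∧ E₀.ncard = k}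

/-- The infimum in the definition of `weakSat` is a minimum: the set of all edges percolates. -/
theorem weakSat_isLeast [Finite V] (G : SimpleGraph V) (H : SimpleGraph W) :
    IsLeast {k | ∃ E₀ : Set (Sym2 V), IsPercolating G H E₀ ∧ E₀.ncard = k} (weakSat G H) :=
  ⟨Nat.sInf_mem ⟨_, G.edgeSet, ⟨subset_rfl, 0, rfl⟩, rfl⟩, fun _ hk => Nat.sInf_le hk⟩

/-- `m_e(G, r)`: the minimum size of a percolating set in the `r`-edge bootstrap percolation
process, that is, in the `S_{r+1}`-bootstrap percolation process. -/
noncomputable def edgePercolationNumber [Finite V] (G : SimpleGraph V) (r : ℕ) : ℕ :=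
  weakSat G (starWithEdges (r + 1))

end Percolation

/-- The `k`-fold nested sum
`∑_{i₁=0}^{s-1} ∑_{i₂=0}^{s-i₁-1} ⋯ ∑_{i_k=0}^{s-i₁-⋯-i_{k-1}-1}
  (s-i₁-⋯-i_k) * C(m,i₁) * C(i₁,i₂) * ⋯ * C(i_{k-1},i_k)`,
defined by splitting off the outermost sum. Since `i < s` in the range of summation, `s - i` is not
truncated, and a sum with upper limit `s - 1 = -1` is empty. -/
def nestedSum : ℕ → ℕ → ℕ → ℕ
  | 0, _, s => s
  | k + 1, m, s => ∑ i ∈ Finset.range s, m.choose i * nestedSum k i (s - i)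

end HammingBootstrap

/-! Write |x| for the coordinate sum of x. Both bounds equal the sum of the truncated differences r
- |x| over x in {0, …, n-1}^d, which `nestedSum_eq_sum` identifies with the nested sum. Upper bound:
each vertex x contributes r - |x| edges that raise a coordinate. Treating vertices by increasing
|x|, the |x| edges that lower a coordinate are already active, so x has r active edges and the rest
follow. Lower bound, by the polynomial method: take a space of polynomials in t, y_1, …, y_d of that
dimension. Substituting y_k = u_k (t - u_k - 2nk) restricts a polynomial to the vertex u, with
degree less than r in t. Restrictions to adjacent u, v agree at t = `edgePoint u v`, so every edge
carries a linear functional. The points at one vertex are distinct, so zeros on r edges at u kill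
the restriction to u. Hence vanishing on a percolating set spreads to all edges, then to all
vertices, and forces the polynomial to be 0. -/

namespace HammingBootstrap

/-! ### Activation in terms of active edges at an endpoint. -/

section Star

variable {V : Type*} {G : SimpleGraph V} {r : ℕ} {E : Set (Sym2 V)}

/-- An edge activated by the `r`-edge process has an endpoint incident to `r` active edges. -/
theorem exists_active_neighbors_of_mem_newlyActive {e : Sym2 V}
    (h : e ∈ newlyActive G (starWithEdges (r + 1)) E) :
    ∃ u v : V, G.Adj u v ∧ e = s(u, v) ∧
      ∃ T : Finset V, T.card = r ∧ ∀ w ∈ T, G.Adj u w ∧ s(u, w) ∈ E := by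
  classical
  obtain ⟨_, S, ⟨φ⟩, heS, hE⟩ := h
  have key : ∀ a b : V, ∀ hab : S.Adj a b, e = s(a, b) → φ ⟨a, hab.fst_mem⟩ = 0 →
      ∃ T : Finset V, T.card = r ∧ ∀ w ∈ T, G.Adj a w ∧ s(a, w) ∈ E := by
    intro a b hab he h0
    set j := φ ⟨b, hab.snd_mem⟩ with hj
    have hj0 : j ≠ 0 := fun h =>
      hab.ne (congrArg Subtype.val (φ.injective (h0.trans (hj ▸ h).symm)))
    have hinj : Function.Injective fun i => (φ.symm i : V) :=
      Subtype.val_injective.comp φ.symm.injective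
    -- Removing the centre and the far end of `e` from the r + 2 star vertices leaves r leaves.
    refine ⟨((Finset.univ.erase (0 : Fin (r + 1 + 1))).erase j).image fun i => (φ.symm i : V),
      ?_, ?_⟩
    · rw [Finset.card_image_of_injective _ hinj,
        Finset.card_erase_of_mem (by simp [hj0]), Finset.card_erase_of_mem (by simp)]
      simp
    · intro w hw
      obtain ⟨i, hi, rfl⟩ := Finset.mem_image.1 hw
      simp only [Finset.mem_erase, Finset.mem_univ, and_true] at hi
      have hadj : S.coe.Adj ⟨a, hab.fst_mem⟩ (φ.symm i) := by
        rw [← φ.map_adj_iff, h0]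
        simp only [RelIso.apply_symm_apply]
        exact SimpleGraph.starGraph_center_adj (Ne.symm hi.2)
      have hadj' : S.Adj a (φ.symm i) := hadj
      refine ⟨hadj'.adj_sub, hE ⟨hadj', fun hmem => hi.1 ?_⟩⟩
      rw [Set.mem_singleton_iff, he] at hmem
      rw [hj, ← φ.apply_symm_apply i]
      exact congrArg φ (Subtype.ext (Sym2.congr_right.1 hmem))
  induction e using Sym2.ind with
  | _ a b =>
    have hab : S.Adj a b := heS
    have hstar : (starWithEdges (r + 1)).Adj (φ ⟨a, hab.fst_mem⟩) (φ ⟨b, hab.snd_mem⟩) :=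
      φ.map_adj_iff.2 hab
    rcases (SimpleGraph.starGraph_adj.1 hstar).2 with h0 | h0
    · exact ⟨a, b, hab.adj_sub, rfl, key a b hab rfl h0⟩
    · exact ⟨b, a, hab.symm.adj_sub, Sym2.eq_swap, key b a hab.symm Sym2.eq_swap h0⟩

/-- In the `r`-edge process, an edge with an endpoint incident to `r` active edges is activated. -/
theorem mem_newlyActive_of_active_neighbors {u v : V} (huv : G.Adj u v) {T : Finset V}
    (hT : T.card = r) (hv : v ∉ T) (hTE : ∀ w ∈ T, G.Adj u w ∧ s(u, w) ∈ E) :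
    s(u, v) ∈ newlyActive G (starWithEdges (r + 1)) E := by
  classical
  refine ⟨huv, ?_⟩
  let g : Fin r → V := fun i => (T.equivFinOfCardEq hT).symm i
  have hgT : ∀ i, g i ∈ T := fun i => ((T.equivFinOfCardEq hT).symm i).2
  have hg : Function.Injective g :=
    Subtype.val_injective.comp (T.equivFinOfCardEq hT).symm.injective
  let leaf : Fin (r + 1) → V := Fin.cons v g
  have hleaf : Function.Injective leaf := by
    rw [Fin.cons_injective_iff]
    exact ⟨by rintro ⟨i, rfl⟩; exact hv (hgT i), hg⟩
  have hadj : ∀ i, G.Adj u (leaf i) := by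
    intro i
    refine Fin.cases huv (fun i => ?_) i
    exact (hTE _ (hgT i)).1
  let f : Fin (r + 1 + 1) → V := Fin.cons u leaf
  have hf : Function.Injective f := by
    rw [Fin.cons_injective_iff]
    exact ⟨by rintro ⟨i, hi⟩; exact (hadj i).ne hi.symm, hleaf⟩
  let F : SimpleGraph.Copy (starWithEdges (r + 1)) G :=
    { toHom :=
        { toFun := f
          map_rel' := by
            intro a b hab
            obtain ⟨hne, h | h⟩ := SimpleGraph.starGraph_adj.1 hab
            · subst h
              obtain ⟨i, rfl⟩ := Fin.exists_succ_eq.2 hne.symm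
              exact hadj i
            · subst h
              obtain ⟨i, rfl⟩ := Fin.exists_succ_eq.2 hne
              exact (hadj i).symm }
      injective' := hf }
  refine ⟨F.toSubgraph, ⟨F.isoToSubgraph.symm⟩, ?_, ?_⟩
  · refine ⟨0, 1, SimpleGraph.starGraph_center_adj (by simp), rfl, rfl⟩
  · rintro e ⟨he, hne⟩
    induction e using Sym2.ind with
    | _ a b =>
      obtain ⟨i, j, hij, rfl, rfl⟩ := he
      have key : ∀ k : Fin (r + 1), s(u, leaf k) ≠ s(u, v) → s(u, leaf k) ∈ E := by
        intro k
        refine Fin.cases (fun h => (h rfl).elim) (fun k _ => ?_) k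
        exact (hTE _ (hgT k)).2
      obtain ⟨hne', h | h⟩ := SimpleGraph.starGraph_adj.1 hij
      · subst h
        obtain ⟨k, rfl⟩ := Fin.exists_succ_eq.2 hne'.symm
        exact key k hne
      · subst h
        obtain ⟨k, rfl⟩ := Fin.exists_succ_eq.2 hne'
        have h1 : s(F.toHom k.succ, F.toHom 0) = s(u, leaf k) := Sym2.eq_swap
        rw [h1] at hne ⊢
        exact key k hne

end Star

theorem activeEdges_subset_edgeSet {V W : Type*} {G : SimpleGraph V} {H : SimpleGraph W}
    {E₀ : Set (Sym2 V)} (h : E₀ ⊆ G.edgeSet) (t : ℕ) : activeEdges G H E₀ t ⊆ G.edgeSet := by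
  induction t with
  | zero => exact h
  | succ t ih => exact Set.union_subset ih fun e he => he.1

theorem subset_activeEdges {V W : Type*} {G : SimpleGraph V} {H : SimpleGraph W}
    {E₀ : Set (Sym2 V)} (t : ℕ) : E₀ ⊆ activeEdges G H E₀ t := by
  induction t with
  | zero => exact subset_rfl
  | succ t ih => exact ih.trans Set.subset_union_left

end HammingBootstrap

namespace HammingBootstrap

/-! ### The nested sum as a weighted lattice point count. -/

section NestedSum

open Polynomial

/-- The linear functional on `ℕ[X]` sending `X ^ j` to the truncated difference `s - j`. -/
noncomputable def deficiency (s : ℕ) : ℕ[X] →ₗ[ℕ] ℕ :=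
  Polynomial.lsum fun j => LinearMap.mulRight ℕ (s - j)

theorem deficiency_X_pow (s j : ℕ) : deficiency s (X ^ j) = s - j := by
  rw [← monomial_one_right_eq_X_pow, deficiency, lsum_apply, sum_monomial_index] <;> simp

theorem deficiency_X_pow_mul (s i : ℕ) (p : ℕ[X]) :
    deficiency s (X ^ i * p) = deficiency (s - i) p := by
  have : (deficiency s).comp (LinearMap.mulLeft ℕ (X ^ i)) = deficiency (s - i) := by
    refine Polynomial.lhom_ext' fun j => LinearMap.ext_ring ?_
    simp only [LinearMap.comp_apply, LinearMap.mulLeft_apply, monomial_one_right_eq_X_pow,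
      ← pow_add, deficiency_X_pow]
    omega
  exact LinearMap.congr_fun this p

theorem deficiency_zero (p : ℕ[X]) : deficiency 0 p = 0 := by
  have : deficiency 0 = 0 := by
    refine Polynomial.lhom_ext' fun j => LinearMap.ext_ring ?_
    simp [monomial_one_right_eq_X_pow, deficiency_X_pow]
  simp [this]

/-- Write the geometric sum as 1 + X * (shorter geometric sum) and expand binomially: each outer
index i shifts s to s - i. -/
theorem deficiency_geom_sum_pow (k m s : ℕ) :
    deficiency s ((∑ j : Fin (k + 1), (X : ℕ[X]) ^ (j : ℕ)) ^ m) = nestedSum k m s := by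
  induction k generalizing m s with
  | zero => simpa [nestedSum] using deficiency_X_pow s 0
  | succ k ih =>
    have hsum : (∑ j : Fin (k + 1 + 1), (X : ℕ[X]) ^ (j : ℕ)) =
        X * (∑ j : Fin (k + 1), X ^ (j : ℕ)) + 1 := by
      rw [Fin.sum_univ_succ, Finset.mul_sum, add_comm]
      simp [pow_succ']
    have hterm : ∀ i, deficiency s ((X * ∑ j : Fin (k + 1), (X : ℕ[X]) ^ (j : ℕ)) ^ i *
        1 ^ (m - i) * (m.choose i : ℕ[X])) = m.choose i * nestedSum k i (s - i) := by
      intro i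
      rw [one_pow, mul_one, mul_comm, ← nsmul_eq_mul, map_nsmul, mul_pow, deficiency_X_pow_mul, ih,
        smul_eq_mul]
    rw [hsum, add_pow, map_sum, nestedSum, Finset.sum_congr rfl fun i _ => hterm i]
    have hzero : ∀ i, s ≤ i → nestedSum k i (s - i) = 0 := by
      intro i hi
      rw [Nat.sub_eq_zero_of_le hi, ← ih, deficiency_zero]
    -- The ranges m + 1 and s are both extended to their maximum; the added terms vanish.
    rw [Finset.sum_subset (Finset.range_mono (le_max_left (m + 1) s)),
      Finset.sum_subset (Finset.range_mono (le_max_right (m + 1) s))]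
    · intro i _ hi
      rw [hzero i (by simpa using hi), mul_zero]
    · intro i _ hi
      rw [Nat.choose_eq_zero_of_lt (by simpa using hi), zero_mul]

/-- The nested sum counts the lattice points of `{0, …, k} ^ m` with weight `s - ∑ i, x i`. -/
theorem nestedSum_eq_sum (k m s : ℕ) :
    nestedSum k m s = ∑ x : Fin m → Fin (k + 1), (s - ∑ i, (x i : ℕ)) := by
  rw [← deficiency_geom_sum_pow, Fintype.sum_pow, map_sum]
  refine Finset.sum_congr rfl fun x _ => ?_
  rw [Finset.prod_pow_eq_pow_sum, deficiency_X_pow]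

end NestedSum

/-! ### Neighbours in the Hamming graph. -/

section Neighbors

variable {n d : ℕ}

theorem hammingGraph_adj_update {x : Fin d → Fin n} {k : Fin d} {b : Fin n} (h : b ≠ x k) :
    (hammingGraph n d).Adj x (Function.update x k b) := by
  refine ⟨k, ?_, fun j hj => ?_⟩
  · simpa using h.symm
  · simp [hj]

theorem exists_eq_update_of_adj {x y : Fin d → Fin n} (h : (hammingGraph n d).Adj x y) :
    ∃ k b, b ≠ x k ∧ y = Function.update x k b := by
  obtain ⟨k, hk, hj⟩ := h
  refine ⟨k, y k, ?_, ?_⟩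
  · exact (Ne.symm hk)
  · ext j
    by_cases hjk : j = k
    · subst hjk; simp
    · simp [hjk, hj j hjk]

/-- The tuples obtained from `x` by replacing one coordinate `x k` by an element of `A k`. -/
def replacements (x : Fin d → Fin n) (A : Fin d → Finset (Fin n)) : Finset (Fin d → Fin n) :=
  (Finset.univ.sigma A).image fun p => Function.update x p.1 p.2

theorem mem_replacements {x y : Fin d → Fin n} {A : Fin d → Finset (Fin n)} :
    y ∈ replacements x A ↔ ∃ k, ∃ b ∈ A k, Function.update x k b = y := by
  simp [replacements]

theorem card_replacements {x : Fin d → Fin n} {A : Fin d → Finset (Fin n)}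
    (h : ∀ k, x k ∉ A k) : (replacements x A).card = ∑ k, (A k).card := by
  rw [replacements, Finset.card_image_of_injOn, Finset.card_sigma]
  rintro ⟨k, b⟩ hk ⟨l, c⟩ hl heq
  simp only [Finset.coe_sigma, Set.mem_sigma_iff, Finset.mem_coe] at hk hl heq
  have hb : b ≠ x k := fun hb => h k (hb ▸ hk.2)
  have hkl : k = l := by
    by_contra hkl
    have := congrFun heq k
    simp [hkl, hb] at this
  subst hkl
  have := congrFun heq k
  simp at this
  rw [this]

end Neighbors

end HammingBootstrap

namespace HammingBootstrap

/-! ### Upper bound: a percolating set built from upward edges. -/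

section UpperBound

variable {n d : ℕ}

theorem weight_update_lt {x : Fin d → Fin n} {k : Fin d} {b : Fin n} (h : b < x k) :
    ∑ i, (Function.update x k b i : ℕ) < ∑ i, (x i : ℕ) := by
  refine Finset.sum_lt_sum (fun i _ => ?_) ⟨k, Finset.mem_univ _, by simpa using h⟩
  by_cases hik : i = k
  · subst hik; simpa using h.le
  · simp [hik]

theorem lt_weight_update {x : Fin d → Fin n} {k : Fin d} {b : Fin n} (h : x k < b) :
    ∑ i, (x i : ℕ) < ∑ i, (Function.update x k b i : ℕ) := by
  refine Finset.sum_lt_sum (fun i _ => ?_) ⟨k, Finset.mem_univ _, by simpa using h⟩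
  by_cases hik : i = k
  · subst hik; simpa using h.le
  · simp [hik]

theorem card_lower_replacements (x : Fin d → Fin n) :
    (replacements x fun k => Finset.Iio (x k)).card = ∑ k, (x k : ℕ) := by
  rw [card_replacements (by simp)]
  simp

theorem card_upper_replacements (x : Fin d → Fin n) :
    (replacements x fun k => Finset.Ioi (x k)).card + ∑ k, (x k : ℕ) = (n - 1) * d := by
  rw [card_replacements (by simp), ← Finset.sum_add_distrib,
    Finset.sum_congr rfl (g := fun _ => n - 1)]
  · simp [mul_comm]
  · intro k _
    rw [Fin.card_Ioi]
    have := (x k).2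
    omega

theorem exists_isPercolating_ncard_le {r : ℕ} (hr : r ≤ (n - 1) * d) :
    ∃ E₀, IsPercolating (hammingGraph n d) (starWithEdges (r + 1)) E₀ ∧
      E₀.ncard ≤ ∑ x : Fin d → Fin n, (r - ∑ i, (x i : ℕ)) := by
  classical
  -- There are (n - 1) * d - |x| upward edges at x, enough since r ≤ (n - 1) * d.
  have hU : ∀ x : Fin d → Fin n, ∃ U ⊆ replacements x fun k => Finset.Ioi (x k),
      U.card = r - ∑ i, (x i : ℕ) := fun x =>
    Finset.exists_subset_card_eq (by have := card_upper_replacements x; omega)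
  choose U hUsub hUcard using hU
  have hUadj : ∀ x, ∀ y ∈ U x, (hammingGraph n d).Adj x y ∧
      ∑ i, (x i : ℕ) < ∑ i, (y i : ℕ) := by
    intro x y hy
    obtain ⟨k, b, hb, rfl⟩ := mem_replacements.1 (hUsub x hy)
    rw [Finset.mem_Ioi] at hb
    exact ⟨hammingGraph_adj_update hb.ne', lt_weight_update hb⟩
  let F : Finset (Sym2 (Fin d → Fin n)) :=
    Finset.univ.biUnion fun x => (U x).image fun y => s(x, y)
  have hF : ∀ x, ∀ y ∈ U x, s(x, y) ∈ (F : Set (Sym2 (Fin d → Fin n))) := fun x y hy =>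
    Finset.mem_biUnion.2 ⟨x, Finset.mem_univ _, Finset.mem_image_of_mem _ hy⟩
  have hFsub : (F : Set (Sym2 (Fin d → Fin n))) ⊆ (hammingGraph n d).edgeSet := by
    intro e he
    obtain ⟨x, -, he⟩ := Finset.mem_biUnion.1 he
    obtain ⟨y, hy, rfl⟩ := Finset.mem_image.1 he
    exact (hUadj x y hy).1
  refine ⟨F, ⟨hFsub, (n - 1) * d + 1, ?_⟩, ?_⟩
  -- At time t all edges at vertices of weight below t are active; the largest weight is (n - 1) *
  -- d.
  · have hactive : ∀ t, ∀ x y, (hammingGraph n d).Adj x y → ∑ i, (x i : ℕ) < t →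
        s(x, y) ∈ activeEdges (hammingGraph n d) (starWithEdges (r + 1)) F t := by
      intro t
      induction t with
      | zero => intro x y _ h; omega
      | succ t ih =>
        intro x y hxy hxt
        let D := replacements x fun k => Finset.Iio (x k)
        have hD : ∀ z ∈ D, (hammingGraph n d).Adj x z ∧ ∑ i, (z i : ℕ) < ∑ i, (x i : ℕ) := by
          intro z hz
          obtain ⟨k, b, hb, rfl⟩ := mem_replacements.1 hz
          rw [Finset.mem_Iio] at hb
          exact ⟨hammingGraph_adj_update hb.ne, weight_update_lt hb⟩
        have hdisj : Disjoint D (U x) := Finset.disjoint_left.2 fun z hzD hzU =>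
          (hD z hzD).2.asymm (hUadj x z hzU).2
        have hDU : ∀ z ∈ D ∪ U x, (hammingGraph n d).Adj x z ∧
            s(x, z) ∈ activeEdges (hammingGraph n d) (starWithEdges (r + 1)) F t := by
          intro z hz
          rcases Finset.mem_union.1 hz with hz | hz
          · have := hD z hz
            refine ⟨this.1, ?_⟩
            rw [Sym2.eq_swap]
            exact ih z x this.1.symm (by omega)
          · exact ⟨(hUadj x z hz).1, subset_activeEdges t (hF x z hz)⟩
        by_cases hy : y ∈ D ∪ U x
        · exact Or.inl (hDU y hy).2
        · obtain ⟨T, hT, hTcard⟩ : ∃ T ⊆ D ∪ U x, T.card = r := by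
            apply Finset.exists_subset_card_eq
            rw [Finset.card_union_of_disjoint hdisj, hUcard, card_lower_replacements]
            omega
          exact Or.inr (mem_newlyActive_of_active_neighbors hxy hTcard (fun h => hy (hT h))
            fun w hw => hDU w (hT hw))
    refine (activeEdges_subset_edgeSet hFsub _).antisymm fun e he => ?_
    induction e using Sym2.ind with
    | _ x y =>
      refine hactive _ x y he ?_
      have := card_upper_replacements x
      omega
  · rw [Set.ncard_coe_finset]
    refine Finset.card_biUnion_le.trans (Finset.sum_le_sum fun x _ => ?_)
    exact Finset.card_image_le.trans (hUcard x).le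

end UpperBound

/-! ### Lower bound: the polynomial method. -/

section LowerBound

open Polynomial

variable {n d : ℕ}

/-- The linear polynomial attached to the value `a` in the `k`-th coordinate. -/
noncomputable def coordinateLine (n : ℕ) {d : ℕ} (k : Fin d) (a : Fin n) : ℚ[X] :=
  C ((a : ℕ) : ℚ) * (X - C (((a : ℕ) + 2 * n * k : ℕ) : ℚ))

/-- The evaluation point attached to the edge `uv`: it is `u k + v k + 2nk` if `u` and `v` differ
exactly in the coordinate `k`. -/
def edgePoint (u v : Fin d → Fin n) : ℕ :=
  ∑ k, if u k = v k then 0 else (u k : ℕ) + v k + 2 * n * k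

theorem edgePoint_update {u : Fin d → Fin n} {k : Fin d} {b : Fin n} (h : b ≠ u k) :
    edgePoint u (Function.update u k b) = (u k : ℕ) + b + 2 * n * k := by
  rw [edgePoint, Finset.sum_eq_single k]
  · simp [h.symm]
  · intro j _ hj
    simp [hj]
  · simp

/-- Since u k + b < 2n, division by 2n recovers the direction k, and then b. -/
theorem edgePoint_injOn (u : Fin d → Fin n) :
    Set.InjOn (edgePoint u) {v | (hammingGraph n d).Adj u v} := by
  intro v hv w hw hvw
  obtain ⟨k, b, hb, rfl⟩ := exists_eq_update_of_adj hv
  obtain ⟨l, c, hc, rfl⟩ := exists_eq_update_of_adj hw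
  rw [edgePoint_update hb, edgePoint_update hc] at hvw
  have hb2 := b.2
  have hc2 := c.2
  have hk2 := (u k).2
  have hl2 := (u l).2
  have hkl : k = l := by
    have hdiv : ∀ (m : Fin d) (a : ℕ), a < 2 * n → (a + 2 * n * m) / (2 * n) = (m : ℕ) := by
      intro m a ha
      rw [Nat.add_mul_div_left _ _ (by omega), Nat.div_eq_of_lt ha, zero_add]
    have h1 := hdiv k (u k + b) (by omega)
    have h2 := hdiv l (u l + c) (by omega)
    exact Fin.ext (by rw [← h1, ← h2, hvw])
  subst hkl
  have hbc : b = c := Fin.ext (by omega)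
  rw [hbc]

/-- The lines a (t - a - m) and b (t - b - m) meet at t = a + b + m. -/
theorem eval_coordinateLine_of_adj {u v : Fin d → Fin n} (h : (hammingGraph n d).Adj u v)
    (j : Fin d) : (coordinateLine n j (u j)).eval (edgePoint u v : ℚ) =
      (coordinateLine n j (v j)).eval (edgePoint u v : ℚ) := by
  obtain ⟨k, b, hb, rfl⟩ := exists_eq_update_of_adj h
  by_cases hj : j = k
  · subst hj
    rw [edgePoint_update hb]
    simp only [coordinateLine, Function.update_self, eval_mul, eval_C, eval_sub, eval_X]
    push_cast
    ring
  · simp [hj]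

theorem coordinateLine_injective (k : Fin d) : Function.Injective (coordinateLine n k) := by
  intro a b h
  have := congrArg (fun p : ℚ[X] => p.coeff 1) h
  simp only [coordinateLine, coeff_C_mul, coeff_sub, coeff_X_one, coeff_C_succ, sub_zero,
    mul_one, Nat.cast_inj] at this
  exact Fin.ext this

theorem degree_coordinateLine_le (k : Fin d) (a : Fin n) : (coordinateLine n k a).degree ≤ 1 := by
  rw [coordinateLine]
  compute_degree

/-- Polynomials in variables `t, y₁, …, y_d` of degree less than `n` in each `y_k` and of total
degree less than `r`, given by their coefficients in `ℚ[t]`. -/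
abbrev CoefficientSpace (n d r : ℕ) : Type :=
  ∀ x : Fin d → Fin n, degreeLT ℚ (r - ∑ i, (x i : ℕ))

theorem finrank_coefficientSpace (n d r : ℕ) :
    Module.finrank ℚ (CoefficientSpace n d r) =
      ∑ x : Fin d → Fin n, (r - ∑ i, (x i : ℕ)) := by
  rw [Module.finrank_pi_fintype]
  refine Finset.sum_congr rfl fun x _ => ?_
  rw [(degreeLTEquiv ℚ _).finrank_eq, Module.finrank_fin_fun]

/-- The restriction of a polynomial in `t, y₁, …, y_d` to the line attached to the vertex `u`. -/
noncomputable def restrictToVertex (r : ℕ) (u : Fin d → Fin n) :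
    CoefficientSpace n d r →ₗ[ℚ] ℚ[X] :=
  ∑ x : Fin d → Fin n,
    (LinearMap.mulRight ℚ (∏ k, coordinateLine n k (u k) ^ (x k : ℕ))).comp
      ((degreeLT ℚ (r - ∑ i, (x i : ℕ))).subtype.comp (LinearMap.proj x))

theorem restrictToVertex_apply (r : ℕ) (u : Fin d → Fin n) (c : CoefficientSpace n d r) :
    restrictToVertex r u c =
      ∑ x : Fin d → Fin n, (c x : ℚ[X]) * ∏ k, coordinateLine n k (u k) ^ (x k : ℕ) := by
  simp [restrictToVertex]

theorem degree_restrictToVertex_lt {r : ℕ} (u : Fin d → Fin n) (c : CoefficientSpace n d r) :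
    (restrictToVertex r u c).degree < r := by
  rw [restrictToVertex_apply, ← mem_degreeLT]
  refine Submodule.sum_mem _ fun x _ => ?_
  rw [mem_degreeLT]
  -- A nonzero coefficient forces |x| < r, so r - |x| is not truncated.
  by_cases h0 : (c x : ℚ[X]) = 0
  · simp [h0]
  have hc := mem_degreeLT.1 (c x).2
  rw [degree_eq_natDegree h0, Nat.cast_lt] at hc
  have hprod : (∏ k, coordinateLine n k (u k) ^ (x k : ℕ)).degree ≤ (∑ k, (x k : ℕ) : ℕ) := by
    refine (degree_prod_le _ _).trans ?_
    rw [Nat.cast_sum]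
    refine Finset.sum_le_sum fun k _ => ?_
    exact (degree_pow_le_of_le _ (degree_coordinateLine_le k (u k))).trans_eq (mul_one _)
  refine (degree_mul_le _ _).trans_lt ((add_le_add_right hprod _).trans_lt ?_)
  rw [degree_eq_natDegree h0, ← Nat.cast_add, Nat.cast_lt]
  omega

theorem eval_restrictToVertex_of_adj {r : ℕ} {u v : Fin d → Fin n}
    (h : (hammingGraph n d).Adj u v) (c : CoefficientSpace n d r) :
    (restrictToVertex r u c).eval (edgePoint u v : ℚ) =
      (restrictToVertex r v c).eval (edgePoint u v : ℚ) := by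
  simp only [restrictToVertex_apply, eval_finsetSum, eval_mul, eval_prod, eval_pow,
    eval_coordinateLine_of_adj h]

theorem edgePoint_comm (u v : Fin d → Fin n) : edgePoint u v = edgePoint v u := by
  refine Finset.sum_congr rfl fun k _ => ?_
  rw [add_comm (u k : ℕ)]
  exact if_congr eq_comm rfl rfl

theorem restrictToVertex_eq_zero {r : ℕ} {u : Fin d → Fin n} {c : CoefficientSpace n d r}
    {T : Finset (Fin d → Fin n)} (hT : r ≤ T.card)
    (h : ∀ w ∈ T, (hammingGraph n d).Adj u w ∧
      (restrictToVertex r u c).eval (edgePoint u w : ℚ) = 0) :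
    restrictToVertex r u c = 0 := by
  by_contra hne
  have hlt := degree_restrictToVertex_lt u c
  rw [degree_eq_natDegree hne, Nat.cast_lt] at hlt
  apply hne
  refine eq_zero_of_natDegree_lt_card_of_eval_eq_zero' _
    (T.image fun w => (edgePoint u w : ℚ)) ?_ ?_
  · intro i hi
    obtain ⟨w, hw, rfl⟩ := Finset.mem_image.1 hi
    exact (h w hw).2
  · rw [Finset.card_image_of_injOn]
    · omega
    · intro v hv w hw hvw
      exact edgePoint_injOn u (h v hv).1 (h w hw).1 (Nat.cast_injective hvw)

/-- A polynomial of degree less than `n` in each `y_k` is determined by its restrictions. -/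
theorem eq_zero_of_restrictToVertex_eq_zero (hn : 0 < n) {r : ℕ} {c : CoefficientSpace n d r}
    (h : ∀ u, restrictToVertex r u c = 0) : c = 0 := by
  classical
  let ex : (Fin d → Fin n) → (Fin d →₀ ℕ) := fun x => Finsupp.equivFunOnFinite.symm fun k => x k
  have hex : Function.Injective ex := fun x y hxy => by
    ext k
    exact DFunLike.congr_fun hxy k
  -- Over ℚ[t], `P` has degree below n in each variable and vanishes on a grid with n values per
  -- variable.
  let P : MvPolynomial (Fin d) ℚ[X] :=
    ∑ x : Fin d → Fin n, MvPolynomial.monomial (ex x) (c x : ℚ[X])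
  have hP : P = 0 := by
    refine MvPolynomial.eq_zero_of_eval_zero_at_prod_finset P
      (fun k => Finset.univ.image (coordinateLine n k)) (fun k => ?_) fun y hy => ?_
    · rw [Finset.card_image_of_injective _ (coordinateLine_injective k), Finset.card_univ,
        Fintype.card_fin]
      refine (MvPolynomial.degreeOf_sum_le _ _ _).trans_lt ((Finset.sup_lt_iff hn).2 fun x _ => ?_)
      by_cases h0 : (c x : ℚ[X]) = 0
      · simpa [h0] using hn
      · rw [MvPolynomial.degreeOf_monomial_eq _ _ h0]
        exact (x k).2
    · have : ∀ k, ∃ a, coordinateLine n k a = y k := fun k => by simpa using hy k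
      choose u hu using this
      have := h u
      rw [restrictToVertex_apply] at this
      simp only [P, map_sum, MvPolynomial.eval_monomial]
      rw [← this]
      refine Finset.sum_congr rfl fun x _ => ?_
      rw [Finsupp.prod_fintype _ _ (by simp)]
      simp [hu, ex]
  funext x
  have := congrArg (MvPolynomial.coeff (ex x)) hP
  simp only [P, MvPolynomial.coeff_sum, MvPolynomial.coeff_monomial, hex.eq_iff,
    Finset.sum_ite_eq', Finset.mem_univ, if_true, MvPolynomial.coeff_zero] at this
  exact Subtype.ext this

theorem sum_le_ncard_of_isPercolating (hn : 0 < n) {r : ℕ} (hr : r ≤ (n - 1) * d)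
    {E₀ : Set (Sym2 (Fin d → Fin n))}
    (hE₀ : IsPercolating (hammingGraph n d) (starWithEdges (r + 1)) E₀) :
    ∑ x : Fin d → Fin n, (r - ∑ i, (x i : ℕ)) ≤ E₀.ncard := by
  classical
  -- The endpoint is chosen arbitrarily; `hvalue` shows that the choice is immaterial.
  let value : Sym2 (Fin d → Fin n) → CoefficientSpace n d r →ₗ[ℚ] ℚ := fun e =>
    (leval (edgePoint (Quot.out e).1 (Quot.out e).2 : ℚ)).comp (restrictToVertex r (Quot.out e).1)
  have hvalue : ∀ u v c, (hammingGraph n d).Adj u v →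
      value s(u, v) c = (restrictToVertex r u c).eval (edgePoint u v : ℚ) := by
    intro u v c huv
    have hout : s((Quot.out s(u, v)).1, (Quot.out s(u, v)).2) = s(u, v) := Quot.out_eq _
    simp only [value, LinearMap.comp_apply, leval_apply]
    rcases Sym2.eq_iff.1 hout with ⟨h1, h2⟩ | ⟨h1, h2⟩
    · rw [h1, h2]
    · rw [h1, h2, eval_restrictToVertex_of_adj huv.symm, edgePoint_comm]
  have : Fintype E₀ := Fintype.ofFinite _
  let Φ : CoefficientSpace n d r →ₗ[ℚ] (E₀ → ℚ) := LinearMap.pi fun e => value e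
  have hΦ : Function.Injective Φ := by
    rw [injective_iff_map_eq_zero]
    intro c hc
    obtain ⟨hsub, t, ht⟩ := hE₀
    have hvanish : ∀ t, ∀ e ∈ activeEdges (hammingGraph n d) (starWithEdges (r + 1)) E₀ t,
        value e c = 0 := by
      intro t
      induction t with
      | zero => exact fun e he => congrFun hc ⟨e, he⟩
      | succ t ih =>
        rintro e (he | he)
        · exact ih e he
        · obtain ⟨u, v, huv, rfl, T, hT, hTE⟩ := exists_active_neighbors_of_mem_newlyActive he
          rw [hvalue u v c huv, restrictToVertex_eq_zero hT.ge fun w hw =>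
            ⟨(hTE w hw).1, (hvalue u w c (hTE w hw).1).symm.trans (ih _ (hTE w hw).2)⟩, eval_zero]
    refine eq_zero_of_restrictToVertex_eq_zero hn fun u => ?_
    -- Every vertex has degree (n - 1) * d ≥ r, so each restriction has enough zeros.
    have hcard : (replacements u fun k => {u k}ᶜ).card = (n - 1) * d := by
      rw [card_replacements (by simp)]
      simp [Finset.card_compl, mul_comm]
    refine restrictToVertex_eq_zero (hr.trans_eq hcard.symm) fun w hw => ?_
    obtain ⟨k, b, hb, rfl⟩ := mem_replacements.1 hw
    have hadj := hammingGraph_adj_update (x := u) (k := k) (b := b) (by simpa using hb)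
    exact ⟨hadj, (hvalue u _ c hadj).symm.trans (hvanish t _ (ht ▸ hadj))⟩
  have := LinearMap.finrank_le_finrank_of_injective hΦ
  rwa [finrank_coefficientSpace, Module.finrank_fintype_fun_eq_card, ← Nat.card_eq_fintype_card,
    Nat.card_coe_set_eq] at this

end LowerBound

end HammingBootstrap

theorem theorem1 (n d r : ℕ) (hn : 2 ≤ n) (hr : r ≤ (n - 1) * d) :
    HammingBootstrap.edgePercolationNumber (HammingBootstrap.hammingGraph n d) r =
      HammingBootstrap.nestedSum (n - 1) d r := by
  open HammingBootstrap in
  have hleast := weakSat_isLeast (hammingGraph n d) (starWithEdges (r + 1))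
  have hsum : nestedSum (n - 1) d r = ∑ x : Fin d → Fin n, (r - ∑ i, (x i : ℕ)) := by
    obtain ⟨m, rfl⟩ : ∃ m, n = m + 1 := ⟨n - 1, by omega⟩
    exact nestedSum_eq_sum m d r
  rw [hsum]
  apply le_antisymm
  · obtain ⟨E₀, hE₀, hcard⟩ := exists_isPercolating_ncard_le hr
    exact (hleast.2 ⟨E₀, hE₀, rfl⟩).trans hcard
  · obtain ⟨E₀, hE₀, hcard⟩ := hleast.1
    exact (sum_le_ncard_of_isPercolating (by omega) hr hE₀).trans_eq hcard
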